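/- For a group $G$ let $\langle G,G\rangle$ be the free group on all pairs $\langle x,y\rangle$ with $x,y\in G$, and write $[x,y]=xyx^{-1}y^{-1}$. Let $Z(G)$ be the kernel of the homomorphism $\langle G,G\rangle\to[G,G]$, $\langle x,y\rangle\mapsto[x,y]$, and let $B(G)\subseteq Z(G)$ be the normal subgroup of $\langle G,G\rangle$ generated by the relations $$\langle x,x\rangle\sim 1,\qquad \langle x,y\rangle\sim\langle y,x\rangle^{-1},\qquad \langle xy,z\rangle\sim\langle y,z\rangle^{x}\langle x,z\rangle,\qquad \langle y,z\rangle^{x}\sim\langle x,[y,z]\rangle\langle y,z\rangle$$ for $x,y,z\in G$, where $\langle y,z\rangle^{x}=\langle xyx^{-1},xzx^{-1}\rangle$. The Schur multiplier of $G$ is $\mathcal M(G)=Z(G)/B(G)$. Let $n\ge 4$ and let $S_n$ be the symmetric group on $\{1,\dots,n\}$. Then $\mathcal M(S_n)\cong\mathbb Z_2$. Moreover the single pair $u=\langle(1,2),(3,4)\rangle$, formed from two disjoint transpositions, lies in $Z(S_n)$, and its class generates $\mathcal M(S_n)$. -/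

import Mathlib

namespace SchurMult

open scoped commutatorElement

variable (G : Type*) [Group G]

/-- The group `⟨G, G⟩`: the free group on all pairs `⟨x, y⟩` of elements of `G`. -/
abbrev PairGroup : Type _ := FreeGroup (G × G)

variable {G} in
/-- The symbol `⟨x, y⟩`, a free generator of `⟨G, G⟩`. -/
def pair (x y : G) : PairGroup G := FreeGroup.of (x, y)

/-- The natural homomorphism sending `⟨x, y⟩` to the commutator `[x, y] = x y x⁻¹ y⁻¹`.
Its image is the commutator subgroup; we take values in `G`, which does not change the kernel. -/
def commHom : PairGroup G →* G := FreeGroup.lift fun p => ⁅p.1, p.2⁆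

/-- `Z(G)`: the kernel of `⟨x, y⟩ ↦ [x, y]`. -/
def Z : Subgroup (PairGroup G) := (commHom G).ker

/-- The defining relations. A relation `a ∼ b` is recorded as the element `a * b⁻¹`, and
`⟨y, z⟩^x` stands for `⟨x y x⁻¹, x z x⁻¹⟩`. -/
inductive Rel : PairGroup G → Prop
  /-- `⟨x, x⟩ ∼ 1` -/
  | diag (x : G) : Rel (pair x x)
  /-- `⟨x, y⟩ ∼ ⟨y, x⟩⁻¹` -/
  | anti (x y : G) : Rel (pair x y * ((pair y x)⁻¹)⁻¹)
  /-- `⟨x y, z⟩ ∼ ⟨y, z⟩^x ⟨x, z⟩` -/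
  | mul_left (x y z : G) :
      Rel (pair (x * y) z * (pair (x * y * x⁻¹) (x * z * x⁻¹) * pair x z)⁻¹)
  /-- `⟨y, z⟩^x ∼ ⟨x, [y, z]⟩ ⟨y, z⟩` -/
  | conj (x y z : G) :
      Rel (pair (x * y * x⁻¹) (x * z * x⁻¹) * (pair x ⁅y, z⁆ * pair y z)⁻¹)

/-- `B(G)`: the normal subgroup of `⟨G, G⟩` generated by the relations. -/
def B : Subgroup (PairGroup G) := Subgroup.normalClosure {w | Rel G w}

instance : (B G).Normal := Subgroup.normalClosure_normal

@[simp] theorem commHom_pair (x y : G) : commHom G (pair x y) = ⁅x, y⁆ := by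
  simp [commHom, pair]

/-- `B(G)` is contained in `Z(G)`, so that the quotient below really is `Z(G)/B(G)`. -/
theorem B_le_Z : B G ≤ Z G := by
  have : (Z G).Normal := MonoidHom.normal_ker _
  refine Subgroup.normalClosure_le_normal ?_
  intro w hw
  change commHom G w = 1
  cases hw <;> simp [commutatorElement_def, mul_assoc]

/-- The Schur multiplier `M(G) = Z(G)/B(G)`. -/
abbrev SchurMultiplier : Type _ := Z G ⧸ (B G).subgroupOf (Z G)

variable {G} in
/-- The class in `M(G)` of an element of `Z(G)`. -/
def cls (w : PairGroup G) (hw : w ∈ Z G) : SchurMultiplier G :=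
  QuotientGroup.mk (s := (B G).subgroupOf (Z G)) ⟨w, hw⟩

end SchurMult

namespace SchurMult

open scoped commutatorElement

/-! M(G) is the kernel of the commutator map `bdry` from G ∧ G to G. The relations make G ∧ G a
crossed module over G (`mul_eq_act_bdry_mul`, `act_eq_wedge_mul`), so this kernel is central and G
acts trivially on it. For S_n, 4-transitivity then makes all wedges of two disjoint transpositions
equal to one element u, and bilinearity gives u² = 1.

Upper bound: G ∧ G is generated by u and the lifts `tri a b c` of three-cycles. Modulo u these
satisfy enough relations (`tri_rotate`, `tri_mul_self`, `tri_mul_wedge`) for a coset enumeration: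
the elements with support in S ∪ {p} whose boundary fixes p already come from S. Removing the points
one by one leaves only powers of u in the kernel.

Lower bound: a central extension of S_n receives a map from G ∧ G given by commutators of lifts. In
a Clifford algebra the transpositions (i j) lift to e_i - e_j, and disjoint ones anticommute, so u
is nontrivial. -/

/-- The nonabelian exterior square `G ∧ G = ⟨G, G⟩ / B(G)`. -/
abbrev ExteriorSquare (G : Type*) [Group G] : Type _ := PairGroup G ⧸ B G

/-! ### Crossed module structure of the exterior square -/

section General

variable {G : Type*} [Group G]

/-- The class of `⟨x, y⟩` in the exterior square. -/
def wedge (x y : G) : ExteriorSquare G := QuotientGroup.mk (pair x y)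

theorem wedge_of_rel {a b : PairGroup G} (h : Rel G (a * b⁻¹)) :
    (QuotientGroup.mk a : ExteriorSquare G) = QuotientGroup.mk b := by
  have h1 : a * b⁻¹ ∈ B G := Subgroup.subset_normalClosure h
  rw [← QuotientGroup.eq_one_iff, QuotientGroup.mk_mul, QuotientGroup.mk_inv] at h1
  exact mul_inv_eq_one.mp h1

@[simp] theorem wedge_self (x : G) : wedge x x = 1 :=
  (QuotientGroup.eq_one_iff _).mpr (Subgroup.subset_normalClosure (Rel.diag x))

theorem wedge_swap (x y : G) : wedge x y = (wedge y x)⁻¹ :=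
  wedge_of_rel (Rel.anti x y)

theorem wedge_mul_left (x y z : G) :
    wedge (x * y) z = wedge (x * y * x⁻¹) (x * z * x⁻¹) * wedge x z :=
  wedge_of_rel (Rel.mul_left x y z)

theorem wedge_conj (x y z : G) :
    wedge (x * y * x⁻¹) (x * z * x⁻¹) = wedge x ⁅y, z⁆ * wedge y z :=
  wedge_of_rel (Rel.conj x y z)

theorem wedge_mul_right (x y z : G) :
    wedge x (y * z) = wedge x y * wedge (y * x * y⁻¹) (y * z * y⁻¹) := by
  rw [wedge_swap, wedge_mul_left, mul_inv_rev, ← wedge_swap, ← wedge_swap]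

@[simp] theorem wedge_one_left (x : G) : wedge 1 x = 1 := by
  simpa using wedge_mul_left 1 1 x

@[simp] theorem wedge_one_right (x : G) : wedge x 1 = 1 := by
  rw [wedge_swap, wedge_one_left, inv_one]

/-- A map on pairs respecting the four relations descends to the exterior square. -/
def wedgeLift {H : Type*} [Group H] (f : G → G → H) (diag : ∀ x, f x x = 1)
    (anti : ∀ x y, f x y = (f y x)⁻¹)
    (mul_left : ∀ x y z, f (x * y) z = f (x * y * x⁻¹) (x * z * x⁻¹) * f x z)
    (conj : ∀ x y z, f (x * y * x⁻¹) (x * z * x⁻¹) = f x ⁅y, z⁆ * f y z) :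
    ExteriorSquare G →* H :=
  QuotientGroup.lift (B G) (FreeGroup.lift fun p => f p.1 p.2) <| by
    suffices h : B G ≤ (FreeGroup.lift fun p : G × G => f p.1 p.2).ker from fun x hx => h hx
    refine Subgroup.normalClosure_le_normal ?_
    intro w hw
    change FreeGroup.lift _ w = 1
    cases hw with
    | diag x => simpa [pair] using diag x
    | anti x y => simpa [pair] using mul_eq_one_iff_eq_inv.mpr (anti x y)
    | mul_left x y z =>
      simp only [pair, map_mul, map_inv, FreeGroup.lift_apply_of]
      exact mul_inv_eq_one.mpr (mul_left x y z)
    | conj x y z =>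
      simp only [pair, map_mul, map_inv, FreeGroup.lift_apply_of]
      exact mul_inv_eq_one.mpr (conj x y z)

@[simp] theorem wedgeLift_wedge {H : Type*} [Group H] (f : G → G → H) (h1 h2 h3 h4) (x y : G) :
    wedgeLift f h1 h2 h3 h4 (wedge x y) = f x y := by
  simp [wedgeLift, wedge, pair]

theorem closure_wedge :
    Subgroup.closure (Set.range fun p : G × G => wedge p.1 p.2) = ⊤ := by
  rw [eq_top_iff]
  rintro w -
  obtain ⟨w, rfl⟩ := QuotientGroup.mk_surjective w
  induction w using FreeGroup.induction_on with
  | C1 => exact one_mem _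
  | of p => exact Subgroup.subset_closure ⟨p, rfl⟩
  | inv_of p h => exact inv_mem h
  | mul a b ha hb => exact mul_mem ha hb

theorem wedge_hom_ext {H : Type*} [Group H] {f g : ExteriorSquare G →* H}
    (h : ∀ x y, f (wedge x y) = g (wedge x y)) : f = g := by
  refine MonoidHom.eq_of_eqOn_dense closure_wedge ?_
  rintro _ ⟨p, rfl⟩
  exact h _ _

/-- The commutator map `G ∧ G → G`. -/
def bdry : ExteriorSquare G →* G :=
  QuotientGroup.lift (B G) (commHom G) fun _ hx => B_le_Z G hx

@[simp] theorem bdry_wedge (x y : G) : bdry (wedge x y) = ⁅x, y⁆ :=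
  commHom_pair G x y

/-- The action of `G` on its exterior square by conjugation of both entries. -/
def act (g : G) : ExteriorSquare G →* ExteriorSquare G :=
  wedgeLift (fun x y => wedge (g * x * g⁻¹) (g * y * g⁻¹))
    (fun _ => wedge_self _) (fun _ _ => wedge_swap _ _)
    (fun x y z => by
      have h := wedge_mul_left (g * x * g⁻¹) (g * y * g⁻¹) (g * z * g⁻¹)
      simpa [mul_assoc] using h)
    (fun x y z => by
      have h := wedge_conj (g * x * g⁻¹) (g * y * g⁻¹) (g * z * g⁻¹)
      simpa [mul_assoc, commutatorElement_def] using h)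

@[simp] theorem act_wedge (g x y : G) :
    act g (wedge x y) = wedge (g * x * g⁻¹) (g * y * g⁻¹) := by
  simp [act]

theorem act_one (w : ExteriorSquare G) : act 1 w = w := by
  have : act (1 : G) = MonoidHom.id _ := wedge_hom_ext fun x y => by simp
  simp [this]

theorem act_mul (g h : G) (w : ExteriorSquare G) : act (g * h) w = act g (act h w) := by
  have : act (g * h) = (act g).comp (act h) := wedge_hom_ext fun x y => by simp [mul_assoc]
  simp [this]

theorem wedge_mul_left' (x y z : G) : wedge (x * y) z = act x (wedge y z) * wedge x z := by
  rw [wedge_mul_left, act_wedge]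

theorem wedge_mul_right' (x y z : G) : wedge x (y * z) = wedge x y * act y (wedge x z) := by
  rw [wedge_mul_right, act_wedge]

/-- Expanding `wedge (x * a) (y * b)` first on the left or first on the right gives two products
with the same outer factors; cancelling them leaves this identity for v = `wedge a b`. -/
theorem act_mul_wedge (x y : G) (v : ExteriorSquare G) :
    act (x * y) v * wedge x y = wedge x y * act (y * x) v := by
  suffices h : act (x * y) = (MulAut.conj (wedge x y)).toMonoidHom.comp (act (y * x)) by
    simp [h]
  refine wedge_hom_ext fun a b => ?_
  have h1 : wedge (x * a) (y * b) = _ := wedge_mul_left' x a (y * b)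
  have h2 : wedge (x * a) (y * b) = _ := wedge_mul_right' (x * a) y b
  rw [wedge_mul_right' a, wedge_mul_right' x, map_mul, ← act_mul] at h1
  rw [wedge_mul_left' x a y, wedge_mul_left' x a b, map_mul, ← act_mul, h1] at h2
  simp only [mul_assoc, mul_right_inj] at h2
  simp only [← mul_assoc, mul_left_inj] at h2
  rw [MonoidHom.comp_apply, MulEquiv.coe_toMonoidHom, MulAut.conj_apply, ← h2]
  group

/-- The Peiffer identity: conjugation by w is the action of its boundary. On generators it is
`act_mul_wedge` applied to a translate of v. -/
theorem mul_eq_act_bdry_mul (w v : ExteriorSquare G) : w * v = act (bdry w) v * w := by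
  have hw : w ∈ Subgroup.closure (Set.range fun p : G × G => wedge p.1 p.2) := by
    rw [closure_wedge]; trivial
  induction hw using Subgroup.closure_induction generalizing v with
  | mem w hw =>
    obtain ⟨⟨x, y⟩, rfl⟩ := hw
    have h := act_mul_wedge x y (act (y * x)⁻¹ v)
    rw [← act_mul, ← act_mul, mul_inv_cancel, act_one] at h
    simpa [commutatorElement_def, mul_assoc] using h.symm
  | one => simp [act_one]
  | mul a b _ _ ha hb => rw [mul_assoc, hb, ← mul_assoc, ha, map_mul, act_mul, mul_assoc]
  | inv a _ ha =>
    have h := ha (act (bdry a)⁻¹ v)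
    rw [← act_mul, mul_inv_cancel, act_one] at h
    rw [map_inv, inv_mul_eq_iff_eq_mul, ← mul_assoc, h, mul_inv_cancel_right]

theorem act_eq_wedge_mul (g : G) (w : ExteriorSquare G) : act g w = wedge g (bdry w) * w := by
  have hw : w ∈ Subgroup.closure (Set.range fun p : G × G => wedge p.1 p.2) := by
    rw [closure_wedge]; trivial
  -- Stated as an equivalence so that b = a⁻¹ also settles inverses.
  have hmul : ∀ a b : ExteriorSquare G, act g a = wedge g (bdry a) * a →
      (act g (a * b) = wedge g (bdry (a * b)) * (a * b) ↔ act g b = wedge g (bdry b) * b) := by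
    intro a b ha
    have h := mul_eq_act_bdry_mul a (wedge g (bdry b))
    rw [map_mul, map_mul, ha, wedge_mul_right', mul_assoc, mul_assoc, mul_right_inj,
      ← mul_assoc (act _ _), ← h, mul_assoc, mul_right_inj]
  induction hw using Subgroup.closure_induction with
  | mem w hw =>
    obtain ⟨⟨x, y⟩, rfl⟩ := hw
    simpa using wedge_conj g x y
  | one => simp
  | mul a b _ _ ha hb => exact (hmul a b ha).mpr hb
  | inv a _ ha => exact (hmul a a⁻¹ ha).mp (by simp)

theorem act_of_bdry_eq_one {w : ExteriorSquare G} (hw : bdry w = 1) (g : G) : act g w = w := by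
  rw [act_eq_wedge_mul, hw, wedge_one_right, one_mul]

theorem comm_of_bdry_eq_one {w : ExteriorSquare G} (hw : bdry w = 1) (v : ExteriorSquare G) :
    w * v = v * w := by
  rw [mul_eq_act_bdry_mul, hw, act_one]

/-! ### Commutators of lifts in a central extension -/

section CentralExtension

variable {C : Type*} [Group C] {π : C →* G}

theorem commutator_eq_of_central (hc : π.ker ≤ Subgroup.center C) {a b a' b' : C}
    (ha : π a' = π a) (hb : π b' = π b) : ⁅a', b'⁆ = ⁅a, b⁆ := by
  have key : ∀ a b a' : C, π a' = π a → ⁅a', b⁆ = ⁅a, b⁆ := by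
    intro a b a' ha
    obtain ⟨z, hz, rfl⟩ : ∃ z ∈ Subgroup.center C, a' = z * a :=
      ⟨a' * a⁻¹, hc (by simp [MonoidHom.mem_ker, ha]), by simp⟩
    have h := Subgroup.mem_center_iff.mp hz (a * b * a⁻¹)
    calc ⁅z * a, b⁆ = z * (a * b * a⁻¹) * z⁻¹ * b⁻¹ := by
          simp only [commutatorElement_def, mul_inv_rev, mul_assoc]
      _ = ⁅a, b⁆ := by rw [← h, mul_inv_cancel_right, commutatorElement_def]
  rw [key a b' a' ha, ← commutatorElement_inv, key b a b' hb, commutatorElement_inv]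

/-- A central extension `π : C → G` induces `G ∧ G → C`, `x ∧ y ↦ [x̃, ỹ]`. -/
noncomputable def wedgeToExtension (hs : Function.Surjective π)
    (hc : π.ker ≤ Subgroup.center C) : ExteriorSquare G →* C :=
  wedgeLift (fun x y => ⁅Function.surjInv hs x, Function.surjInv hs y⁆)
    (fun _ => commutatorElement_self _)
    (fun _ _ => (commutatorElement_inv _ _).symm)
    (fun x y z => by
      have e := Function.surjInv_eq hs
      set s := Function.surjInv hs
      rw [commutator_eq_of_central hc (a' := s (x * y)) (a := s x * s y) (b := s z) (by simp [e]) rfl,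
        commutator_eq_of_central hc (a' := s (x * y * x⁻¹)) (a := s x * s y * (s x)⁻¹)
          (b' := s (x * z * x⁻¹)) (b := s x * s z * (s x)⁻¹)
          (by simp [e]) (by simp [e])]
      simp [commutatorElement_def, mul_assoc])
    (fun x y z => by
      have e := Function.surjInv_eq hs
      set s := Function.surjInv hs
      rw [commutator_eq_of_central hc (a := s x) (b' := s ⁅y, z⁆) (b := ⁅s y, s z⁆) rfl
          (by simp [e, commutatorElement_def]),
        commutator_eq_of_central hc (a' := s (x * y * x⁻¹)) (a := s x * s y * (s x)⁻¹)
          (b' := s (x * z * x⁻¹)) (b := s x * s z * (s x)⁻¹)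
          (by simp [e]) (by simp [e])]
      simp [commutatorElement_def, mul_assoc])

theorem wedgeToExtension_wedge (hs : Function.Surjective π)
    (hc : π.ker ≤ Subgroup.center C) (a b : C) :
    wedgeToExtension hs hc (wedge (π a) (π b)) = ⁅a, b⁆ := by
  rw [wedgeToExtension, wedgeLift_wedge]
  exact commutator_eq_of_central hc (Function.surjInv_eq hs _) (Function.surjInv_eq hs _)

end CentralExtension

end General

/-! ### Nontriviality of u, by a Clifford algebra -/

section Lower

variable {ι A : Type*} [DecidableEq ι] [Ring A]

/-- Pairs `(x, σ)` of a unit `x` and a permutation `σ` such that conjugation by `x` sends `e i` to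
`sign σ • e (σ i)`. -/
def signedCover [Fintype ι] (e : ι → A) : Subgroup (Aˣ × Equiv.Perm ι) where
  carrier := {p | ∀ i, (p.1 : A) * e i = Equiv.Perm.sign p.2 • (e (p.2 i) * p.1)}
  one_mem' := by simp
  mul_mem' := by
    intro p q hp hq i
    simp only [Set.mem_ofPred_eq] at hp hq
    simp only [Prod.fst_mul, Prod.snd_mul, Units.val_mul, Equiv.Perm.mul_apply, map_mul]
    rw [mul_assoc, hq, mul_smul_comm, ← mul_assoc, hp, smul_mul_assoc, smul_smul, mul_assoc,
      mul_comm (Equiv.Perm.sign p.2)]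
  inv_mem' := by
    intro p hp i
    simp only [Set.mem_ofPred_eq] at hp
    have h := hp (p.2⁻¹ i)
    rw [show p.2 (p.2⁻¹ i) = i from p.2.apply_symm_apply i] at h
    simp only [Prod.fst_inv, Prod.snd_inv, map_inv, Int.units_inv_eq_self]
    rw [Units.inv_mul_eq_iff_eq_mul, mul_smul_comm, ← mul_assoc, h, smul_mul_assoc, smul_smul,
      Int.units_mul_self, one_smul, mul_assoc, Units.mul_inv, mul_one]

/-- The projection of the signed cover to the symmetric group. -/
def signedCover.proj [Fintype ι] (e : ι → A) : signedCover e →* Equiv.Perm ι :=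
  (MonoidHom.snd _ _).comp (signedCover e).subtype

variable {e : ι → A}

/-- The unit `e i - e j` of square two. -/
noncomputable def diffUnit [Algebra ℝ A] (hsq : ∀ i, e i * e i = 1)
    (hanti : ∀ i j, i ≠ j → e i * e j = -(e j * e i)) (i j : ι) (hij : i ≠ j) : Aˣ :=
  have h : (e i - e j) * (e i - e j) = (2 : ℝ) • 1 := by
    rw [mul_sub, sub_mul, sub_mul, hsq, hsq, hanti i j hij, two_smul]; abel
  { val := e i - e j
    inv := (1 / 2 : ℝ) • (e i - e j)
    val_inv := by rw [mul_smul_comm, h, smul_smul]; norm_num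
    inv_val := by rw [smul_mul_assoc, h, smul_smul]; norm_num }

theorem diffUnit_mem [Fintype ι] [Algebra ℝ A] (hsq : ∀ i, e i * e i = 1)
    (hanti : ∀ i j, i ≠ j → e i * e j = -(e j * e i)) (i j : ι) (hij : i ≠ j) :
    (diffUnit hsq hanti i j hij, Equiv.swap i j) ∈ signedCover e := by
  intro k
  change (e i - e j) * e k = Equiv.Perm.sign (Equiv.swap i j) • (e (Equiv.swap i j k) * (e i - e j))
  -- Conjugation by a vector is minus the reflection in it, hence the sign twist in `signedCover`.
  rw [Equiv.Perm.sign_swap hij, Units.smul_def, Units.val_neg, Units.val_one, neg_one_smul]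
  rcases eq_or_ne k i with rfl | hki
  · rw [Equiv.swap_apply_left, sub_mul, mul_sub, hsq, hsq]; abel
  rcases eq_or_ne k j with rfl | hkj
  · rw [Equiv.swap_apply_right, sub_mul, mul_sub, hsq, hsq]; abel
  · rw [Equiv.swap_apply_of_ne_of_ne hki hkj, sub_mul, mul_sub, hanti k i hki, hanti k j hkj]; abel

theorem signedCover.proj_surjective [Fintype ι] [Algebra ℝ A] (hsq : ∀ i, e i * e i = 1)
    (hanti : ∀ i j, i ≠ j → e i * e j = -(e j * e i)) :
    Function.Surjective (signedCover.proj e) := by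
  rw [← MonoidHom.range_eq_top, eq_top_iff, ← Equiv.Perm.closure_isSwap, Subgroup.closure_le]
  rintro _ ⟨i, j, hij, rfl⟩
  exact ⟨⟨_, diffUnit_mem hsq hanti i j hij⟩, rfl⟩

theorem signedCover.ker_proj_le_center [Fintype ι]
    (hgen : ∀ x : A, (∀ i, Commute x (e i)) → ∀ y, Commute x y) :
    (signedCover.proj e).ker ≤ Subgroup.center (signedCover e) := by
  rintro ⟨⟨x, σ⟩, hx⟩ (rfl : σ = 1)
  rw [Subgroup.mem_center_iff]
  rintro ⟨⟨y, τ⟩, -⟩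
  have h : Commute (x : A) y := hgen _ (fun i => by simpa [Commute, SemiconjBy] using hx i) _
  ext1
  exact Prod.ext (Units.ext h.symm) (by simp)

theorem wedge_swap_swap_ne_one_of_algebra [Fintype ι] [Algebra ℝ A] [Nontrivial A]
    (hsq : ∀ i, e i * e i = 1)
    (hanti : ∀ i j, i ≠ j → e i * e j = -(e j * e i))
    (hgen : ∀ x : A, (∀ i, Commute x (e i)) → ∀ y, Commute x y)
    {a b c d : ι} (hab : a ≠ b) (hac : a ≠ c) (had : a ≠ d) (hbc : b ≠ c) (hbd : b ≠ d)
    (hcd : c ≠ d) : wedge (Equiv.swap a b) (Equiv.swap c d) ≠ 1 := by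
  intro h
  have h1 := wedgeToExtension_wedge (signedCover.proj_surjective hsq hanti)
    (signedCover.ker_proj_le_center hgen) ⟨_, diffUnit_mem hsq hanti a b hab⟩
    ⟨_, diffUnit_mem hsq hanti c d hcd⟩
  change wedgeToExtension _ _ (wedge (Equiv.swap a b) (Equiv.swap c d)) = _ at h1
  rw [h, map_one, eq_comm, commutatorElement_eq_one_iff_mul_comm] at h1
  have h2 : (e a - e b) * (e c - e d) = (e c - e d) * (e a - e b) :=
    congrArg (fun p : signedCover e => (p.1.1 : A)) h1
  have h3 : (e a - e b) * (e c - e d) = -((e c - e d) * (e a - e b)) := by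
    rw [sub_mul, mul_sub, mul_sub, hanti a c hac, hanti a d had, hanti b c hbc, hanti b d hbd,
      sub_mul, mul_sub, mul_sub]
    abel
  -- If u were trivial, the two lifts would both commute and anticommute, although their product is
  -- a unit.
  have h4 : (2 : ℝ) • ((e c - e d) * (e a - e b)) = 0 := by
    rw [two_smul]; nth_rw 1 [← h2, h3]; exact neg_add_cancel _
  have h5 := (smul_eq_zero_iff_right (two_ne_zero (α := ℝ))).mp h4
  exact (diffUnit hsq hanti c d hcd * diffUnit hsq hanti a b hab).ne_zero h5

theorem wedge_swap_swap_ne_one [Fintype ι]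
    {a b c d : ι} (hab : a ≠ b) (hac : a ≠ c) (had : a ≠ d) (hbc : b ≠ c) (hbd : b ≠ d)
    (hcd : c ≠ d) : wedge (Equiv.swap a b) (Equiv.swap c d) ≠ 1 := by
  let Q : QuadraticForm ℝ (ι → ℝ) := QuadraticMap.weightedSumSquares ℝ fun _ => (1 : ℝ)
  have hQ : ∀ v : ι → ℝ, Q v = ∑ i, v i * v i := fun v => by
    simp [Q, QuadraticMap.weightedSumSquares_apply]
  have : Nontrivial (CliffordAlgebra Q) := inferInstance
  refine wedge_swap_swap_ne_one_of_algebra (A := CliffordAlgebra Q)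
    (e := fun i => CliffordAlgebra.ι Q (Pi.single i 1)) ?_ ?_ ?_ hab hac had hbc hbd hcd
  · intro i
    rw [CliffordAlgebra.ι_sq_scalar, hQ, Finset.sum_eq_single i] <;>
      simp +contextual
  · intro i j hij
    refine CliffordAlgebra.ι_mul_ι_comm_of_isOrtho ?_
    rw [QuadraticMap.isOrtho_def, hQ, hQ, hQ, ← Finset.sum_add_distrib]
    refine Finset.sum_congr rfl fun k _ => ?_
    rcases eq_or_ne k i with rfl | hki
    · simp [hij]
    · simp [hki]
  · intro x hx y
    induction y using CliffordAlgebra.induction with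
    | algebraMap r => exact (Algebra.commutes r x).symm
    | ι v =>
      rw [pi_eq_sum_univ' v, map_sum]
      refine Commute.sum_right _ _ _ fun i _ => ?_
      rw [map_smul]
      refine Commute.smul_right ?_ _
      convert hx i using 3
    | mul a b ha hb => exact ha.mul_right hb
    | add a b ha hb => exact ha.add_right hb

end Lower

/-! ### Lifts of three-cycles and coset enumeration -/

section Upper

open Equiv (swap)
open Equiv.Perm

variable {α : Type*} [DecidableEq α]

theorem act_wedge_swap (σ : Equiv.Perm α) (a b c d : α) :
    act σ (wedge (swap a b) (swap c d)) = wedge (swap (σ a) (σ b)) (swap (σ c) (σ d)) := by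
  rw [act_wedge, Equiv.swap_apply_apply, Equiv.swap_apply_apply]

/-- The class of `⟨(a b), (b c)⟩`, a lift of the three-cycle `a ↦ c ↦ b ↦ a`. -/
def tri (a b c : α) : ExteriorSquare (Equiv.Perm α) := wedge (swap a b) (swap b c)

theorem act_tri (σ : Equiv.Perm α) (a b c : α) : act σ (tri a b c) = tri (σ a) (σ b) (σ c) :=
  act_wedge_swap σ a b b c

theorem bdry_tri (a b c : α) : bdry (tri a b c) = ⁅swap a b, swap b c⁆ := bdry_wedge _ _

theorem tri_inv (a b c : α) : (tri a b c)⁻¹ = tri c b a := by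
  rw [tri, tri, ← wedge_swap, Equiv.swap_comm b c, Equiv.swap_comm a b]

theorem bdry_tri_left {a b c : α} (hab : a ≠ b) (hac : a ≠ c) (hbc : b ≠ c) :
    bdry (tri a b c) a = c := by
  simp [bdry_tri, commutatorElement_def, Equiv.swap_apply_of_ne_of_ne, hab, hac,
    hac.symm, hbc.symm]

theorem bdry_tri_mid {a b c : α} (hac : a ≠ c) (hbc : b ≠ c) :
    bdry (tri a b c) b = a := by
  simp [bdry_tri, commutatorElement_def, Equiv.swap_apply_of_ne_of_ne, hac.symm,
    hbc.symm]

theorem bdry_tri_right {a b c : α} (hab : a ≠ b) (hac : a ≠ c) :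
    bdry (tri a b c) c = b := by
  simp [bdry_tri, commutatorElement_def, Equiv.swap_apply_of_ne_of_ne, hab, hac]

theorem bdry_tri_of_ne {a b c x : α} (ha : x ≠ a) (hb : x ≠ b) (hc : x ≠ c) :
    bdry (tri a b c) x = x := by
  simp [bdry_tri, commutatorElement_def, Equiv.swap_apply_of_ne_of_ne, *]

/-- By the Peiffer identity an element is fixed by its own boundary, which here rotates the three
points. -/
theorem tri_rotate {a b c : α} (hab : a ≠ b) (hac : a ≠ c) (hbc : b ≠ c) :
    tri a b c = tri b c a := by
  have h := mul_eq_act_bdry_mul (tri b c a) (tri b c a)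
  rw [mul_left_inj, act_tri, bdry_tri_left hbc hab.symm hac.symm,
    bdry_tri_mid hab.symm hac.symm, bdry_tri_right hbc hab.symm] at h
  exact h.symm

/-- With `tri_inv`, this says that the lift of a three-cycle has trivial cube. It follows by
expanding `tri b a c` along (a c) = (b c)(a b)(b c). -/
theorem tri_mul_self {a b c : α} (hab : a ≠ b) (hac : a ≠ c) (hbc : b ≠ c) :
    tri a b c * tri a b c = tri c b a := by
  have e : swap a c = swap b c * (swap a b * swap b c) := by
    rw [← mul_assoc, Equiv.swap_mul_swap_mul_swap hab hac, Equiv.swap_comm]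
  have h : tri b a c = tri a b c * act (swap b c) (act (swap a b) (tri a b c)) := by
    rw [tri, e, Equiv.swap_comm b a, wedge_mul_right', wedge_mul_right', wedge_self, one_mul]; rfl
  rw [act_tri, act_tri] at h
  simp only [Equiv.swap_apply_left, Equiv.swap_apply_right,
    Equiv.swap_apply_of_ne_of_ne hab hac,
    Equiv.swap_apply_of_ne_of_ne hac.symm hbc.symm] at h
  rw [tri_rotate hac.symm hbc.symm hab] at h
  rw [← h, tri_rotate hab.symm hbc hac, tri_rotate hac hab hbc.symm]

theorem bdry_wedge_disjoint {a b c d : α} (hac : a ≠ c) (had : a ≠ d) (hbc : b ≠ c) (hbd : b ≠ d) :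
    bdry (wedge (swap a b) (swap c d)) = 1 := by
  rw [bdry_wedge, commutatorElement_eq_one_iff_mul_comm, Equiv.mul_swap_eq_swap_mul,
    Equiv.swap_apply_of_ne_of_ne hac.symm hbc.symm, Equiv.swap_apply_of_ne_of_ne had.symm hbd.symm]

/-- Both sides expand the wedge of (a b) with (b c)(c d) = (b d)(b c). -/
theorem tri_mul_wedge {a b c d : α} (hab : a ≠ b) (hac : a ≠ c) (had : a ≠ d) (hbc : b ≠ c)
    (hbd : b ≠ d) (hcd : c ≠ d) :
    tri a b c * wedge (swap a b) (swap c d) = tri a b d * tri a d c := by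
  have e : swap b c * swap c d = swap b d * swap b c := by
    rw [Equiv.mul_swap_eq_swap_mul, Equiv.swap_apply_right,
      Equiv.swap_apply_of_ne_of_ne hbd.symm hcd.symm]
  have h := wedge_mul_right' (swap a b) (swap b c) (swap c d)
  rw [act_of_bdry_eq_one (bdry_wedge_disjoint hac had hbc hbd), e, wedge_mul_right',
    ← tri, ← tri, act_tri, Equiv.swap_apply_of_ne_of_ne hab had, Equiv.swap_apply_left,
    Equiv.swap_apply_of_ne_of_ne hbc.symm hcd] at h
  exact h.symm

/-- The subgroup of the exterior square generated by `u` and the lifts of three-cycles with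
support in `S`. -/
def triSubgroup (u : ExteriorSquare (Equiv.Perm α)) (S : Finset α) :
    Subgroup (ExteriorSquare (Equiv.Perm α)) :=
  Subgroup.closure (insert u
    {w | ∃ a ∈ S, ∃ b ∈ S, ∃ c ∈ S, a ≠ b ∧ a ≠ c ∧ b ≠ c ∧ w = tri a b c})

variable {u : ExteriorSquare (Equiv.Perm α)} {S : Finset α}

theorem mem_triSubgroup : u ∈ triSubgroup u S :=
  Subgroup.subset_closure (Set.mem_insert _ _)

theorem tri_mem_triSubgroup {a b c : α} (ha : a ∈ S) (hb : b ∈ S) (hc : c ∈ S) (hab : a ≠ b)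
    (hac : a ≠ c) (hbc : b ≠ c) : tri a b c ∈ triSubgroup u S :=
  Subgroup.subset_closure (Or.inr ⟨a, ha, b, hb, c, hc, hab, hac, hbc, rfl⟩)

theorem bdry_tri_mem {a b c x : α} (ha : a ∈ S) (hb : b ∈ S) (hc : c ∈ S) (hab : a ≠ b)
    (hac : a ≠ c) (hbc : b ≠ c) (hx : x ∈ S) : bdry (tri a b c) x ∈ S := by
  rcases eq_or_ne x a with rfl | hxa
  · rwa [bdry_tri_left hab hac hbc]
  rcases eq_or_ne x b with rfl | hxb
  · rwa [bdry_tri_mid hac hbc]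
  rcases eq_or_ne x c with rfl | hxc
  · rwa [bdry_tri_right hab hac]
  · rwa [bdry_tri_of_ne hxa hxb hxc]

theorem bdry_apply_of_mem_triSubgroup (hb : bdry u = 1) {w : ExteriorSquare (Equiv.Perm α)}
    (hw : w ∈ triSubgroup u S) {p : α} (hp : p ∉ S) : bdry w p = p := by
  induction hw using Subgroup.closure_induction with
  | mem w hw =>
    rcases hw with rfl | ⟨a, ha, b, hb, c, hc, -, -, -, rfl⟩
    · rw [hb, Equiv.Perm.one_apply]
    · exact bdry_tri_of_ne (by rintro rfl; exact hp ha) (by rintro rfl; exact hp hb)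
        (by rintro rfl; exact hp hc)
  | one => simp
  | mul a b _ _ ha hb => rw [map_mul, Equiv.Perm.mul_apply, hb, ha]
  | inv a _ ha => rw [map_inv, Equiv.Perm.inv_eq_iff_eq, ha]

/-- The union of the cosets of `triSubgroup u S` whose elements move `p` inside `S ∪ {p}`. -/
def IsCosetForm (u : ExteriorSquare (Equiv.Perm α)) (S : Finset α) (p : α)
    (w : ExteriorSquare (Equiv.Perm α)) : Prop :=
  w ∈ triSubgroup u S ∨
    ∃ d ∈ S, ∃ j ∈ S, d ≠ j ∧ ∃ v ∈ triSubgroup u S, w = tri p d j * v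

theorem tri_mul_of_disjoint
    (hu : ∀ a b c d : α, a ≠ b → a ≠ c → a ≠ d → b ≠ c → b ≠ d → c ≠ d →
      wedge (swap a b) (swap c d) = u) {a b c d : α} (hab : a ≠ b) (hac : a ≠ c) (had : a ≠ d)
    (hbc : b ≠ c) (hbd : b ≠ d) (hcd : c ≠ d) : tri a b d * tri a d c = tri a b c * u := by
  rw [← tri_mul_wedge hab hac had hbc hbd hcd, hu a b c d hab hac had hbc hbd hcd]

theorem mul_isCosetForm {p : α} {z : ExteriorSquare (Equiv.Perm α)} (hz : z ∈ triSubgroup u S)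
    (hz1 : bdry z = 1) {w : ExteriorSquare (Equiv.Perm α)} (hw : IsCosetForm u S p w) :
    IsCosetForm u S p (z * w) := by
  rcases hw with hw | ⟨d, hd, j, hj, hdj, v, hv, rfl⟩
  · exact Or.inl (mul_mem hz hw)
  · refine Or.inr ⟨d, hd, j, hj, hdj, z * v, mul_mem hz hv, ?_⟩
    rw [← mul_assoc, comm_of_bdry_eq_one hz1, mul_assoc]

section Cosets

variable {p : α} (hp : p ∉ S) (hb : bdry u = 1)
  (hu : ∀ a b c d : α, a ≠ b → a ≠ c → a ≠ d → b ≠ c → b ≠ d → c ≠ d →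
    wedge (swap a b) (swap c d) = u)

include hp

theorem tri_mul_isCosetForm' {a b c : α} (ha : a ∈ S) (hb : b ∈ S) (hc : c ∈ S) (hab : a ≠ b)
    (hac : a ≠ c) (hbc : b ≠ c) {w : ExteriorSquare (Equiv.Perm α)} (hw : IsCosetForm u S p w) :
    IsCosetForm u S p (tri a b c * w) := by
  have ht : tri a b c ∈ triSubgroup u S := tri_mem_triSubgroup ha hb hc hab hac hbc
  rcases hw with hw | ⟨d, hd, j, hj, hdj, v, hv, rfl⟩
  · exact Or.inl (mul_mem ht hw)
  · refine Or.inr ⟨_, bdry_tri_mem ha hb hc hab hac hbc hd, _,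
      bdry_tri_mem ha hb hc hab hac hbc hj, fun h => hdj (Equiv.injective _ h), _,
      mul_mem ht hv, ?_⟩
    have hfix : bdry (tri a b c) p = p := bdry_tri_of_ne (by rintro rfl; exact hp ha)
      (by rintro rfl; exact hp hb) (by rintro rfl; exact hp hc)
    rw [← mul_assoc, mul_eq_act_bdry_mul (tri a b c), act_tri, hfix, mul_assoc]

include hu

/-- The coset of `tri p d j` depends only on `j`. -/
theorem exists_tri_mul_eq {d d' j : α} (hd : d ∈ S) (hd' : d' ∈ S) (hj : j ∈ S)
    (hdj : d ≠ j) (hdj' : d' ≠ j) {v : ExteriorSquare (Equiv.Perm α)} (hv : v ∈ triSubgroup u S) :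
    ∃ v' ∈ triSubgroup u S, tri p d j * v = tri p d' j * v' := by
  rcases eq_or_ne d d' with rfl | hdd
  · exact ⟨v, hv, rfl⟩
  have hpd : p ≠ d := by rintro rfl; exact hp hd
  have hpd' : p ≠ d' := by rintro rfl; exact hp hd'
  have hpj : p ≠ j := by rintro rfl; exact hp hj
  -- Solve `tri j p d' * tri j d' d = tri j p d * u` for `tri j p d`, which is `tri p d j` rotated.
  refine ⟨tri j d' d * u⁻¹ * v, mul_mem (mul_mem (tri_mem_triSubgroup hj hd' hd hdj'.symm hdj.symm
    hdd.symm) (inv_mem mem_triSubgroup)) hv, ?_⟩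
  have h := tri_mul_of_disjoint hu hpj.symm hdj.symm hdj'.symm hpd hpd' hdd
  rw [← tri_rotate hpj.symm hdj.symm hpd, ← tri_rotate hpj.symm hdj'.symm hpd', ← mul_assoc,
    ← mul_assoc, h, mul_inv_cancel_right]

theorem tri_mul_isCosetForm {x y : α} (hx : x ∈ S) (hy : y ∈ S) (hxy : x ≠ y)
    {w : ExteriorSquare (Equiv.Perm α)} (hw : IsCosetForm u S p w) :
    IsCosetForm u S p (tri p x y * w) := by
  have hpx : p ≠ x := by rintro rfl; exact hp hx
  have hpy : p ≠ y := by rintro rfl; exact hp hy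
  rcases hw with hw | ⟨d, hd, j, hj, hdj, v, hv, rfl⟩
  · exact Or.inr ⟨x, hx, y, hy, hxy, w, hw, rfl⟩
  have hpj : p ≠ j := by rintro rfl; exact hp hj
  -- The auxiliary point d is first changed to y (to x when j = y). The product then collapses by
  -- inversion if j = x, by squaring if j = y, and by `tri_mul_of_disjoint` otherwise.
  rcases eq_or_ne j x with rfl | hjx
  · obtain ⟨v', hv', e⟩ := exists_tri_mul_eq hp hu hd hy hj hdj hxy.symm hv
    left
    rw [e, tri_rotate hpy hpx hxy.symm, ← tri_inv p j y, mul_inv_cancel_left]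
    exact hv'
  rcases eq_or_ne j y with rfl | hjy
  · obtain ⟨v', hv', e⟩ := exists_tri_mul_eq hp hu hd hx hj hdj hxy hv
    right
    refine ⟨j, hy, x, hx, hxy.symm, v', hv', ?_⟩
    rw [e, ← mul_assoc, tri_mul_self hpx hpy hxy, tri_rotate hpy hpx hxy.symm]
  · obtain ⟨v', hv', e⟩ := exists_tri_mul_eq hp hu hd hy hj hdj hjy.symm hv
    right
    refine ⟨x, hx, j, hj, hjx.symm, u * v', mul_mem mem_triSubgroup hv', ?_⟩
    rw [e, ← mul_assoc, ← mul_assoc, tri_mul_of_disjoint hu hpx hpj hpy hjx.symm hxy hjy]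

theorem tri_mul_isCosetForm_insert {a b c : α} (ha : a ∈ insert p S) (hb : b ∈ insert p S)
    (hc : c ∈ insert p S) (hab : a ≠ b) (hac : a ≠ c) (hbc : b ≠ c)
    {w : ExteriorSquare (Equiv.Perm α)} (hw : IsCosetForm u S p w) :
    IsCosetForm u S p (tri a b c * w) := by
  rcases eq_or_ne a p with rfl | hap
  · exact tri_mul_isCosetForm hp hu (Finset.mem_of_mem_insert_of_ne hb hab.symm)
      (Finset.mem_of_mem_insert_of_ne hc hac.symm) hbc hw
  rcases eq_or_ne b p with rfl | hbp
  · rw [tri_rotate hab hac hbc]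
    exact tri_mul_isCosetForm hp hu (Finset.mem_of_mem_insert_of_ne hc hbc.symm)
      (Finset.mem_of_mem_insert_of_ne ha hab) hac.symm hw
  rcases eq_or_ne c p with rfl | hcp
  · rw [← tri_rotate hac.symm hbc.symm hab]
    exact tri_mul_isCosetForm hp hu (Finset.mem_of_mem_insert_of_ne ha hac)
      (Finset.mem_of_mem_insert_of_ne hb hbc) hab hw
  · exact tri_mul_isCosetForm' hp (Finset.mem_of_mem_insert_of_ne ha hap)
      (Finset.mem_of_mem_insert_of_ne hb hbp) (Finset.mem_of_mem_insert_of_ne hc hcp) hab hac hbc hw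

include hb

theorem isCosetForm_of_mem {w : ExteriorSquare (Equiv.Perm α)}
    (hw : w ∈ triSubgroup u (insert p S)) : IsCosetForm u S p w := by
  induction hw using Subgroup.closure_induction_left with
  | one => exact Or.inl (one_mem _)
  | mul_left x hx y _ ih =>
    rcases hx with rfl | ⟨a, ha, b, hb', c, hc, hab, hac, hbc, rfl⟩
    · exact mul_isCosetForm mem_triSubgroup hb ih
    · exact tri_mul_isCosetForm_insert hp hu ha hb' hc hab hac hbc ih
  | inv_mul_cancel x hx y _ ih =>
    rcases hx with rfl | ⟨a, ha, b, hb', c, hc, hab, hac, hbc, rfl⟩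
    · exact mul_isCosetForm (inv_mem mem_triSubgroup) (by rw [map_inv, hb, inv_one]) ih
    · rw [tri_inv]
      exact tri_mul_isCosetForm_insert hp hu hc hb' ha hbc.symm hac.symm hab.symm ih

/-- An element of the coset of `tri p d j` sends p to j ≠ p, so only the trivial coset survives. -/
theorem mem_triSubgroup_of_insert {w : ExteriorSquare (Equiv.Perm α)}
    (hw : w ∈ triSubgroup u (insert p S)) (hw1 : bdry w p = p) : w ∈ triSubgroup u S := by
  rcases isCosetForm_of_mem hp hb hu hw with h | ⟨d, hd, j, hj, hdj, v, hv, rfl⟩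
  · exact h
  · have hpj : p ≠ j := by rintro rfl; exact hp hj
    have hpd : p ≠ d := by rintro rfl; exact hp hd
    rw [map_mul, Equiv.Perm.mul_apply, bdry_apply_of_mem_triSubgroup hb hv hp,
      bdry_tri_left hpd hpj hdj] at hw1
    exact absurd hw1.symm hpj

end Cosets

theorem mem_zpowers_of_mem_triSubgroup (hb : bdry u = 1)
    (hu : ∀ a b c d : α, a ≠ b → a ≠ c → a ≠ d → b ≠ c → b ≠ d → c ≠ d →
      wedge (swap a b) (swap c d) = u) {w : ExteriorSquare (Equiv.Perm α)} (hw1 : bdry w = 1)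
    (hw : w ∈ triSubgroup u S) : w ∈ Subgroup.zpowers u := by
  induction S using Finset.induction_on with
  | empty => simpa [triSubgroup, Subgroup.zpowers_eq_closure] using hw
  | insert p S hp ih => exact ih (mem_triSubgroup_of_insert hp hb hu hw (by simp [hw1]))

theorem act_mem_triSubgroup [Fintype α] (hb : bdry u = 1) (σ : Equiv.Perm α)
    {w : ExteriorSquare (Equiv.Perm α)} (hw : w ∈ triSubgroup u Finset.univ) :
    act σ w ∈ triSubgroup u Finset.univ := by
  suffices h : triSubgroup u Finset.univ ≤ (triSubgroup u Finset.univ).comap (act σ) from h hw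
  refine (Subgroup.closure_le _).mpr ?_
  rintro w (hw | ⟨a, -, b, -, c, -, hab, hac, hbc, rfl⟩)
  · change act σ w ∈ triSubgroup u Finset.univ
    rw [hw, act_of_bdry_eq_one hb]
    exact mem_triSubgroup
  · change act σ (tri a b c) ∈ triSubgroup u Finset.univ
    rw [act_tri]
    exact tri_mem_triSubgroup (Finset.mem_univ _) (Finset.mem_univ _) (Finset.mem_univ _)
      (σ.injective.ne hab) (σ.injective.ne hac) (σ.injective.ne hbc)

theorem wedge_swap_swap_mem [Fintype α]
    (hu : ∀ a b c d : α, a ≠ b → a ≠ c → a ≠ d → b ≠ c → b ≠ d → c ≠ d →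
      wedge (swap a b) (swap c d) = u) {a b c d : α} (hab : a ≠ b) (hcd : c ≠ d) :
    wedge (swap a b) (swap c d) ∈ triSubgroup u Finset.univ := by
  have key : ∀ a b d : α, a ≠ b → b ≠ d →
      wedge (swap a b) (swap b d) ∈ triSubgroup u Finset.univ := by
    intro a b d hab hbd
    rcases eq_or_ne a d with rfl | had
    · rw [Equiv.swap_comm b a, wedge_self]
      exact one_mem _
    · exact tri_mem_triSubgroup (Finset.mem_univ _) (Finset.mem_univ _) (Finset.mem_univ _)
        hab had hbd
  rcases eq_or_ne b c with rfl | hbc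
  · exact key _ _ _ hab hcd
  rcases eq_or_ne b d with rfl | hbd
  · rw [Equiv.swap_comm c b]
    exact key _ _ _ hab hcd.symm
  rw [Equiv.swap_comm a b]
  rcases eq_or_ne a c with rfl | hac
  · exact key _ _ _ hab.symm hcd
  rcases eq_or_ne a d with rfl | had
  · rw [Equiv.swap_comm c a]
    exact key _ _ _ hab.symm hcd.symm
  rw [hu b a c d hab.symm hbc hbd hac had hcd]
  exact mem_triSubgroup

/-- Writing both entries as products of transpositions reduces a wedge to translates of wedges of
transpositions, and the subgroup is stable under the action. -/
theorem triSubgroup_univ [Fintype α] (hb : bdry u = 1)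
    (hu : ∀ a b c d : α, a ≠ b → a ≠ c → a ≠ d → b ≠ c → b ≠ d → c ≠ d →
      wedge (swap a b) (swap c d) = u) : triSubgroup u (Finset.univ : Finset α) = ⊤ := by
  rw [eq_top_iff, ← closure_wedge, Subgroup.closure_le]
  rintro _ ⟨⟨x, y⟩, rfl⟩
  change wedge x y ∈ triSubgroup u Finset.univ
  induction x using Equiv.Perm.swap_induction_on with
  | one => rw [wedge_one_left]; exact one_mem _
  | swap_mul f a b hab ih =>
    rw [wedge_mul_left']
    refine mul_mem (act_mem_triSubgroup hb _ ih) ?_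
    clear ih
    induction y using Equiv.Perm.swap_induction_on with
    | one => rw [wedge_one_right]; exact one_mem _
    | swap_mul g c d hcd ih =>
      rw [wedge_mul_right']
      exact mul_mem (wedge_swap_swap_mem hu hab hcd) (act_mem_triSubgroup hb _ ih)

end Upper

/-! ### The kernel as the group of order two generated by u -/

theorem wedge_swap_swap_eq {α : Type*} [DecidableEq α] {a b c d a' b' c' d' : α}
    (hab : a ≠ b) (hac : a ≠ c) (had : a ≠ d) (hbc : b ≠ c) (hbd : b ≠ d) (hcd : c ≠ d)
    (hab' : a' ≠ b') (hac' : a' ≠ c') (had' : a' ≠ d') (hbc' : b' ≠ c') (hbd' : b' ≠ d')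
    (hcd' : c' ≠ d') :
    wedge (Equiv.swap a b) (Equiv.swap c d) = wedge (Equiv.swap a' b') (Equiv.swap c' d') := by
  have inj : ∀ {a b c d : α}, a ≠ b → a ≠ c → a ≠ d → b ≠ c → b ≠ d → c ≠ d →
      Function.Injective ![a, b, c, d] := by
    intro a b c d hab hac had hbc hbd hcd i j h
    fin_cases i <;> fin_cases j <;> simp_all
  -- Some permutation carries one quadruple to the other, and it acts trivially on the kernel of
  -- `bdry`.
  have := Equiv.Perm.isMultiplyPretransitive α 4
  obtain ⟨σ, hσ⟩ := MulAction.exists_smul_eq (Equiv.Perm α)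
    (⟨_, inj hab hac had hbc hbd hcd⟩ : Fin 4 ↪ α) ⟨_, inj hab' hac' had' hbc' hbd' hcd'⟩
  have h := fun i => DFunLike.congr_fun hσ i
  have h0 : σ a = a' := h 0
  have h1 : σ b = b' := h 1
  have h2 : σ c = c' := h 2
  have h3 : σ d = d' := h 3
  rw [← h0, ← h1, ← h2, ← h3, ← act_wedge_swap,
    act_of_bdry_eq_one (bdry_wedge_disjoint hac had hbc hbd)]

theorem mem_zpowers_wedge_of_bdry_eq_one {α : Type*} [DecidableEq α] [Fintype α] {a b c d : α}
    (hab : a ≠ b) (hac : a ≠ c) (had : a ≠ d) (hbc : b ≠ c) (hbd : b ≠ d) (hcd : c ≠ d)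
    {w : ExteriorSquare (Equiv.Perm α)} (hw : bdry w = 1) :
    w ∈ Subgroup.zpowers (wedge (Equiv.swap a b) (Equiv.swap c d)) := by
  have hb := bdry_wedge_disjoint hac had hbc hbd
  have hu := fun a' b' c' d' hab' hac' had' hbc' hbd' hcd' =>
    (wedge_swap_swap_eq (a := a') (b := b') (c := c') (d := d') hab' hac' had' hbc' hbd' hcd'
      hab hac had hbc hbd hcd)
  refine mem_zpowers_of_mem_triSubgroup hb hu hw (S := Finset.univ) ?_
  rw [triSubgroup_univ hb hu]
  trivial

/-- Since the action on u is trivial, u² is the wedge of (a b) with (c d)² = 1. -/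
theorem wedge_swap_swap_mul_self {α : Type*} [DecidableEq α] {a b c d : α}
    (hac : a ≠ c) (had : a ≠ d) (hbc : b ≠ c) (hbd : b ≠ d) :
    wedge (Equiv.swap a b) (Equiv.swap c d) * wedge (Equiv.swap a b) (Equiv.swap c d) = 1 := by
  have h := wedge_mul_right' (Equiv.swap a b) (Equiv.swap c d) (Equiv.swap c d)
  rw [act_of_bdry_eq_one (bdry_wedge_disjoint hac had hbc hbd), Equiv.swap_mul_self,
    wedge_one_right] at h
  exact h.symm

theorem mk_eq_one_iff {G : Type*} [Group G] (w : Z G) :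
    (QuotientGroup.mk w : SchurMultiplier G) = 1 ↔
      (QuotientGroup.mk w.1 : ExteriorSquare G) = 1 := by
  rw [QuotientGroup.eq_one_iff, QuotientGroup.eq_one_iff, Subgroup.mem_subgroupOf]

theorem mulEquiv_zmod_two_of_zpowers {M : Type*} [Group M] {g : M} (hg : g ≠ 1) (hg2 : g ^ 2 = 1)
    (h : Subgroup.zpowers g = ⊤) : Nonempty (M ≃* Multiplicative (ZMod 2)) := by
  have : IsCyclic M := ⟨g, Subgroup.eq_top_iff' _ |>.mp h⟩
  refine ⟨mulEquivOfCyclicCardEq ?_⟩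
  have h2 : orderOf g = 2 := orderOf_eq_prime hg2 hg
  rw [← Subgroup.card_top (G := M), ← h, Nat.card_zpowers, h2]
  simp

end SchurMult

open SchurMult in
theorem mainTheorem8 (n : ℕ) (hn : 4 ≤ n) :
    Nonempty (SchurMult.SchurMultiplier (Equiv.Perm (Fin n)) ≃* Multiplicative (ZMod 2)) ∧
    ∃ hu : SchurMult.pair
          (Equiv.swap (⟨0, by omega⟩ : Fin n) ⟨1, by omega⟩)
          (Equiv.swap (⟨2, by omega⟩ : Fin n) ⟨3, by omega⟩) ∈
        SchurMult.Z (Equiv.Perm (Fin n)),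
      Subgroup.zpowers (SchurMult.cls _ hu) = ⊤ := by
  set a : Fin n := ⟨0, by omega⟩
  set b : Fin n := ⟨1, by omega⟩
  set c : Fin n := ⟨2, by omega⟩
  set d : Fin n := ⟨3, by omega⟩
  have hab : a ≠ b := by simp [a, b]
  have hac : a ≠ c := by simp [a, c]
  have had : a ≠ d := by simp [a, d]
  have hbc : b ≠ c := by simp [b, c]
  have hbd : b ≠ d := by simp [b, d]
  have hcd : c ≠ d := by simp [c, d]
  have hu : pair (Equiv.swap a b) (Equiv.swap c d) ∈ Z (Equiv.Perm (Fin n)) :=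
    bdry_wedge_disjoint hac had hbc hbd
  have htop : Subgroup.zpowers (cls _ hu) = ⊤ := by
    rw [eq_top_iff]
    rintro w -
    obtain ⟨w, rfl⟩ := QuotientGroup.mk_surjective w
    obtain ⟨k, hk⟩ := mem_zpowers_wedge_of_bdry_eq_one hab hac had hbc hbd hcd
      (w := (QuotientGroup.mk w.1 : ExteriorSquare (Equiv.Perm (Fin n)))) w.2
    refine ⟨k, ?_⟩
    change QuotientGroup.mk (⟨_, hu⟩ ^ k : Z (Equiv.Perm (Fin n))) = QuotientGroup.mk w
    rw [← inv_mul_eq_one, ← QuotientGroup.mk_inv, ← QuotientGroup.mk_mul, mk_eq_one_iff]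
    exact inv_mul_eq_one.mpr hk
  refine ⟨mulEquiv_zmod_two_of_zpowers ?_ ?_ htop, hu, htop⟩
  · exact fun h => wedge_swap_swap_ne_one hab hac had hbc hbd hcd ((mk_eq_one_iff _).mp h)
  · rw [pow_two]
    let z : Z (Equiv.Perm (Fin n)) := ⟨_, hu⟩
    exact (mk_eq_one_iff (z * z)).mpr (wedge_swap_swap_mul_self hac had hbc hbd)
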